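/- **Setting.** Let $d\ge 1$ and let two parties hold the two factors of a bipartite finite-dimensional system $A\otimes B$, each local system having a fixed computational basis. A *CLODCC operation* is a linear map from operators on $A\otimes B$ to operators on some $A'\otimes B'$ that is a finite or (convergent) infinite composition of the following steps: (i) conjugation by a local unitary $U\otimes I$ or $I\otimes U$ (a local unitary may also identify a local system with another system of the same dimension, in particular with a product of subsystems); (ii) one party sends a subsystem $C$ of its local system to the other party through the dephasing channel $|c\rangle\langle c'|\mapsto\delta_{cc'}|c\rangle\langle c|$ in the computational basis of $C$. No ancillas are added and no subsystem is discarded. A POVM $M=(M^i)_i$ with finitely many outcomes on $\mathcal H$ has the measurement map $\Lambda_M(X)=\sum_i \mathrm{Tr}(M^iX)\,|i\rangle\langle i|$. Let $J$ be the set of POVMs on $A\otimes B$ for which $\Lambda_M$ is a CLODCC operation, where $(|i\rangle)_i$ is the computational product basis of an output system $A'\otimes B'$ of the two parties. For a state $\rho$ on $\mathcal H=A\otimes B$ put $$D_J(\rho)=\sup_{M\in J} D\Big(\Lambda_M(\rho)\,\Big\|\,\Lambda_M\big(\tfrac{I}{\dim \mathcal H}\big)\Big),$$ where $D$ is the Kullback--Leibler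 relative entropy of the two outcome distributions, and $$D_J^\infty(\rho)=\lim_{n\to\infty}\tfrac1n D_J(\rho^{\otimes n}),$$ where $\rho^{\otimes n}$ is regarded as a bipartite state on $A^{\otimes n}\otimes B^{\otimes n}$. All logarithms are to base 2. On the right-hand side below, $D(\sigma\|\tau)=\mathrm{Tr}\,\sigma(\log\sigma-\log\tau)$ is the quantum relative entropy. **Theorem.** Let $\rho$ be a density operator on $\mathbb C^d\otimes\mathbb C^d$ and let $\rho^\Gamma=(\mathrm{id}\otimes(\cdot)^\top)(\rho)$ be its partial transpose on the second factor, taken in the computational basis. If $\rho^\Gamma\ge 0$, then the limit defining $D_J^\infty(\rho)$ exists and $$D_J^\infty(\rho)\le D\Big(\rho^\Gamma\,\Big\|\,\frac{I}{d^2}\Big).$$ -/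

import Mathlib

open Matrix Filter Topology
open scoped ComplexOrder Kronecker

noncomputable section

/-! A finite-dimensional quantum system with a fixed computational basis is given by the finite
type of labels of that basis; operators on it are the square complex matrices over that type. -/

/-- Density operators: positive semidefinite with trace one. -/
def IsDensityOperator {H : Type} [Fintype H] (ρ : Matrix H H ℂ) : Prop :=
  ρ.PosSemidef ∧ ρ.trace = 1

/-- The maximally mixed state `I / dim H`. -/
def maximallyMixed (H : Type) [Fintype H] [DecidableEq H] : Matrix H H ℂ :=
  ((Fintype.card H : ℂ)⁻¹) • (1 : Matrix H H ℂ)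

/-- Partial transposition `Γ = id ⊗ (·)ᵀ` (transposition of the second factor in the
computational basis). -/
def partialTranspose {A B : Type} (X : Matrix (A × B) (A × B) ℂ) : Matrix (A × B) (A × B) ℂ :=
  Matrix.of fun x y => X (x.1, y.2) (y.1, x.2)

/-- `n` copies of a bipartite operator on `A ⊗ B`, seen as a bipartite operator on
`A^{⊗n} ⊗ B^{⊗n}`. -/
def tensorCopies {A B : Type} (ρ : Matrix (A × B) (A × B) ℂ) (n : ℕ) :
    Matrix ((Fin n → A) × (Fin n → B)) ((Fin n → A) × (Fin n → B)) ℂ :=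
  Matrix.of fun x y => ∏ k, ρ (x.1 k, x.2 k) (y.1 k, y.2 k)

/-! ### Relative entropies (in bits) -/

open Classical in
/-- Kullback–Leibler relative entropy `∑ pᵢ log₂ (pᵢ / qᵢ)` of two distributions on a finite set;
it is `∞` unless `p` vanishes wherever `q` does. -/
def klRelativeEntropy {ι : Type} [Fintype ι] (p q : ι → ℝ) : EReal :=
  if ∀ i, q i = 0 → p i = 0 then ((∑ i, p i * Real.logb 2 (p i / q i) : ℝ) : EReal) else ⊤

open Classical in
/-- Quantum relative entropy `D(σ‖τ) = Tr σ (log₂ σ - log₂ τ)`; it is `∞` unless the kernel of `τ`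
is contained in the kernel of `σ`. The logarithm is applied by the functional calculus, with
`log 0 = 0`. -/
def quantumRelativeEntropy {H : Type} [Fintype H] [DecidableEq H] (σ τ : Matrix H H ℂ) : EReal :=
  if ∀ v : H → ℂ, τ *ᵥ v = 0 → σ *ᵥ v = 0 then
    (((σ * (cfc (Real.logb 2) σ - cfc (Real.logb 2) τ)).trace.re : ℝ) : EReal)
  else ⊤

/-! ### Measurements -/

/-- A POVM on `H` with finitely many outcomes. -/
structure POVM (H : Type) [Fintype H] [DecidableEq H] where
  Outcome : Type
  [fintypeOutcome : Fintype Outcome]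
  [decidableEqOutcome : DecidableEq Outcome]
  elem : Outcome → Matrix H H ℂ
  posSemidef : ∀ i, (elem i).PosSemidef
  sum_eq_one : ∑ i, elem i = 1

attribute [instance] POVM.fintypeOutcome POVM.decidableEqOutcome

/-- The measurement map `Λ_M : X ↦ ∑ᵢ Tr(Mⁱ X) |i⟩⟨i|`. -/
def POVM.measurementMap {H : Type} [Fintype H] [DecidableEq H] (M : POVM H) :
    Matrix H H ℂ →ₗ[ℂ] Matrix M.Outcome M.Outcome ℂ where
  toFun X := Matrix.diagonal fun i => (M.elem i * X).trace
  map_add' X Y := by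
    ext i j
    by_cases h : i = j <;> simp [Matrix.diagonal, h, Matrix.mul_add]
  map_smul' c X := by
    ext i j
    by_cases h : i = j <;> simp [Matrix.diagonal, h]

/-- The distribution of the outcomes: the diagonal of `Λ_M(ρ)`. -/
def POVM.distribution {H : Type} [Fintype H] [DecidableEq H] (M : POVM H) (ρ : Matrix H H ℂ)
    (i : M.Outcome) : ℝ :=
  (M.measurementMap ρ i i).re

/-! ### Closed local operations and communication through a dephasing channel -/

/-- Conjugation `X ↦ V X V†`. -/
def conjugationMap {H K : Type} [Fintype H] (V : Matrix K H ℂ) :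
    Matrix H H ℂ →ₗ[ℂ] Matrix K K ℂ where
  toFun X := V * X * Vᴴ
  map_add' X Y := by simp [Matrix.mul_add, Matrix.add_mul]
  map_smul' c X := by simp

/-- `V` is the matrix of a unitary operator between the spaces with bases `H` and `K`. -/
def IsUnitaryMap {H K : Type} [Fintype H] [DecidableEq H] [Fintype K] [DecidableEq K]
    (V : Matrix K H ℂ) : Prop :=
  Vᴴ * V = 1 ∧ V * Vᴴ = 1

/-- The first party sends her subsystem `C` to the second party through the dephasing channel
`|c⟩⟨c'| ↦ δ_{cc'} |c⟩⟨c|`. -/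
def sendRight (A C B : Type) [DecidableEq C] :
    Matrix ((A × C) × B) ((A × C) × B) ℂ →ₗ[ℂ] Matrix (A × (C × B)) (A × (C × B)) ℂ where
  toFun X := Matrix.of fun x y =>
    if x.2.1 = y.2.1 then X ((x.1, x.2.1), x.2.2) ((y.1, y.2.1), y.2.2) else 0
  map_add' X Y := by
    ext x y
    by_cases h : x.2.1 = y.2.1 <;> simp [h]
  map_smul' c X := by
    ext x y
    by_cases h : x.2.1 = y.2.1 <;> simp [h]

/-- The second party sends his subsystem `C` to the first party through the dephasing channel. -/
def sendLeft (A C B : Type) [DecidableEq C] :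
    Matrix (A × (C × B)) (A × (C × B)) ℂ →ₗ[ℂ] Matrix ((A × C) × B) ((A × C) × B) ℂ where
  toFun X := Matrix.of fun x y =>
    if x.1.2 = y.1.2 then X (x.1.1, (x.1.2, x.2)) (y.1.1, (y.1.2, y.2)) else 0
  map_add' X Y := by
    ext x y
    by_cases h : x.1.2 = y.1.2 <;> simp [h]
  map_smul' c X := by
    ext x y
    by_cases h : x.1.2 = y.1.2 <;> simp [h]

/-- The composition `E (k-1) ∘ ⋯ ∘ E 1 ∘ E 0`. -/
def iteratedComp {V : Type} [AddCommMonoid V] [Module ℂ V] (E : ℕ → V →ₗ[ℂ] V) :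
    ℕ → V →ₗ[ℂ] V
  | 0 => LinearMap.id
  | k + 1 => E k ∘ₗ iteratedComp E k

/-- `IsCLODCC Λ`: the map `Λ` from operators on `A ⊗ B` to operators on `A' ⊗ B'` belongs to the
class generated, under finite and (convergent) infinite composition, by the local unitaries of the
two parties and by sending subsystems through the dephasing channel in either direction. No
ancillas are added and nothing is discarded. A local unitary may also identify a local system with
another one of the same dimension, in particular with a product of two subsystems, one of which
can then be sent. -/
inductive IsCLODCC : ∀ {A B A' B' : Type},
    (Matrix (A × B) (A × B) ℂ →ₗ[ℂ] Matrix (A' × B') (A' × B') ℂ) → Prop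
  | id {A B : Type} [Fintype A] [DecidableEq A] [Fintype B] [DecidableEq B] :
      IsCLODCC (LinearMap.id : Matrix (A × B) (A × B) ℂ →ₗ[ℂ] Matrix (A × B) (A × B) ℂ)
  | unitaryLeft {A A' B : Type} [Fintype A] [DecidableEq A] [Fintype A'] [DecidableEq A']
      [Fintype B] [DecidableEq B] (U : Matrix A' A ℂ) (hU : IsUnitaryMap U) :
      IsCLODCC (conjugationMap (U ⊗ₖ (1 : Matrix B B ℂ)))
  | unitaryRight {A B B' : Type} [Fintype A] [DecidableEq A] [Fintype B] [DecidableEq B]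
      [Fintype B'] [DecidableEq B'] (U : Matrix B' B ℂ) (hU : IsUnitaryMap U) :
      IsCLODCC (conjugationMap ((1 : Matrix A A ℂ) ⊗ₖ U))
  | sendRight {A C B : Type} [Fintype A] [DecidableEq A] [Fintype C] [DecidableEq C]
      [Fintype B] [DecidableEq B] : IsCLODCC (sendRight A C B)
  | sendLeft {A C B : Type} [Fintype A] [DecidableEq A] [Fintype C] [DecidableEq C]
      [Fintype B] [DecidableEq B] : IsCLODCC (sendLeft A C B)
  | comp {A₀ B₀ A₁ B₁ A₂ B₂ : Type} [Fintype A₀] [DecidableEq A₀] [Fintype B₀] [DecidableEq B₀]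
      [Fintype A₁] [DecidableEq A₁] [Fintype B₁] [DecidableEq B₁]
      [Fintype A₂] [DecidableEq A₂] [Fintype B₂] [DecidableEq B₂]
      (Λ₂ : Matrix (A₁ × B₁) (A₁ × B₁) ℂ →ₗ[ℂ] Matrix (A₂ × B₂) (A₂ × B₂) ℂ)
      (Λ₁ : Matrix (A₀ × B₀) (A₀ × B₀) ℂ →ₗ[ℂ] Matrix (A₁ × B₁) (A₁ × B₁) ℂ) :
      IsCLODCC Λ₂ → IsCLODCC Λ₁ → IsCLODCC (Λ₂ ∘ₗ Λ₁)
  | infiniteComp {A B : Type} [Fintype A] [DecidableEq A] [Fintype B] [DecidableEq B]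
      (E : ℕ → Matrix (A × B) (A × B) ℂ →ₗ[ℂ] Matrix (A × B) (A × B) ℂ)
      (Λ : Matrix (A × B) (A × B) ℂ →ₗ[ℂ] Matrix (A × B) (A × B) ℂ) :
      (∀ k, IsCLODCC (E k)) →
      (∀ X, Tendsto (fun k => iteratedComp E k X) atTop (𝓝 (Λ X))) →
      IsCLODCC Λ

/-- The set `J` of the POVMs on `A ⊗ B` whose measurement map is a CLODCC operation, the basis
vectors `|i⟩` of the outcomes being the computational product basis of some output system
`A' ⊗ B'` of the two parties. -/
def clodccPOVMs (A B : Type) [Fintype A] [DecidableEq A] [Fintype B] [DecidableEq B] :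
    Set (POVM (A × B)) :=
  {M | ∃ (A' B' : Type) (e : M.Outcome ≃ A' × B'),
    IsCLODCC ((Matrix.reindexLinearEquiv ℂ ℂ e e).toLinearMap ∘ₗ M.measurementMap)}

/-! ### Restricted relative entropy distance from the maximally mixed state -/

/-- `D_S(ρ) = sup_{M ∈ S} D(Λ_M(ρ) ‖ Λ_M(I / dim))` for a set `S` of POVMs. -/
def restrictedRelativeEntropy {H : Type} [Fintype H] [DecidableEq H] (S : Set (POVM H))
    (ρ : Matrix H H ℂ) : EReal :=
  ⨆ M ∈ S, klRelativeEntropy (M.distribution ρ) (M.distribution (maximallyMixed H))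

/-- `D_J(ρ^{⊗n})`, where `J` is the set of the CLODCC measurements between the two parties who hold
`A^{⊗n}` and `B^{⊗n}`. -/
def clodccRelativeEntropyCopies {A B : Type} [Fintype A] [DecidableEq A] [Fintype B]
    [DecidableEq B] (ρ : Matrix (A × B) (A × B) ℂ) (n : ℕ) : EReal :=
  restrictedRelativeEntropy (clodccPOVMs (Fin n → A) (Fin n → B)) (tensorCopies ρ n)

/-- `D_J^∞(ρ) = lim_{n → ∞} (1/n) D_J(ρ^{⊗n})`. -/
def regularizedCLODCCRelativeEntropy {A B : Type} [Fintype A] [DecidableEq A] [Fintype B]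
    [DecidableEq B] (ρ : Matrix (A × B) (A × B) ℂ) : EReal :=
  limUnder atTop fun n : ℕ => clodccRelativeEntropyCopies ρ n / (n : EReal)

end

/-! Write Γ for partial transposition. The class of CLODCC operations is invariant under `Λ ↦ Γ ∘ Λ
∘ Γ`: a unitary on the second party becomes its complex conjugate, and dephasing a sent system makes
transposing it immaterial (`IsCLODCC.partialTranspose_conj`). Since CLODCC operations are positive
and Γ does not change diagonal entries, a measurement in J satisfies `Tr(Mⁱ P^Γ) ≥ 0` for every `P ≥
0`. They are also unital, so `Tr Mⁱ = 1`.

Decompose `ρ^Γ = ∑ qⱼ Pⱼ` spectrally. The outcome probabilities are `pᵢ = ∑ⱼ Kᵢⱼ qⱼ` with `Kᵢⱼ =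
Tr(Mⁱ Pⱼ^Γ)`, and K is doubly stochastic, so convexity of `x log x` gives `∑ pᵢ log pᵢ ≤ ∑ qⱼ log
qⱼ` (`sum_mulLogb_distribution_le`). Against I/dim the outcomes are uniform, so adding `log dim`
turns this into a bound on relative entropies. For n copies the spectrum is the product distribution
of q, and the bound is n times the one for a single copy (`clodcc_copies_le`).

The limit exists by Fekete's lemma: products of CLODCC measurements are CLODCC
(`POVM.prod_mem_clodccPOVMs`), so `D_J(ρ^{⊗n})` is superadditive, and the bound above keeps its
growth linear. -/

noncomputable section

/-! ### Positive semidefinite matrices -/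

theorem posSemidef_of_tendsto {H : Type} {X : ℕ → Matrix H H ℂ} {Y : Matrix H H ℂ}
    (hX : ∀ k, (X k).PosSemidef) (hXY : Tendsto X atTop (𝓝 Y)) : Y.PosSemidef := by
  have entry : ∀ i j, Tendsto (fun k => X k i j) atTop (𝓝 (Y i j)) := fun i j =>
    tendsto_pi_nhds.1 (tendsto_pi_nhds.1 hXY i) j
  refine ⟨?_, fun x => ?_⟩
  · ext i j
    refine tendsto_nhds_unique (f := fun k => X k i j) (l := atTop) ?_ (entry i j)
    exact (entry j i).star.congr fun k => (hX k).1.apply i j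
  · refine ge_of_tendsto' (x := atTop) (f := fun k => x.sum fun i xi => x.sum fun j xj =>
      star xi * X k i j * xj) ?_ fun k => (hX k).2 x
    refine tendsto_finsetSum _ fun i _ => tendsto_finsetSum _ fun j _ => ?_
    exact ((entry i j).const_mul _).mul_const _

/-- Dephasing is the pinching `∑_c Π_c X Π_c†` by the coordinate projections onto the level sets of
`f`. Both sending maps are such a pinching followed by a relabelling. -/
theorem Matrix.PosSemidef.dephase {H C : Type} [Fintype H] [DecidableEq H] [Fintype C]
    [DecidableEq C] {X : Matrix H H ℂ} (hX : X.PosSemidef) (f : H → C) :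
    (Matrix.of fun x y => if f x = f y then X x y else 0).PosSemidef := by
  have key : (Matrix.of fun x y => if f x = f y then X x y else 0) =
      ∑ c, (diagonal fun x => if f x = c then (1 : ℂ) else 0) * X *
        (diagonal fun x => if f x = c then (1 : ℂ) else 0)ᴴ := by
    ext x y
    simp only [Matrix.sum_apply, diagonal_conjTranspose, mul_diagonal, diagonal_mul, Pi.star_apply,
      of_apply, apply_ite star, star_one, star_zero, ite_mul, one_mul, zero_mul, mul_ite, mul_one,
      mul_zero]
    simp [eq_comm]
  rw [key]
  exact posSemidef_sum _ fun c _ => hX.mul_mul_conjTranspose_same _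

theorem posSemidef_sendRight {A C B : Type} [Fintype A] [DecidableEq A] [Fintype C]
    [DecidableEq C] [Fintype B] [DecidableEq B] {X : Matrix ((A × C) × B) ((A × C) × B) ℂ}
    (hX : X.PosSemidef) : (sendRight A C B X).PosSemidef :=
  (hX.dephase fun x => x.1.2).submatrix fun x : A × (C × B) => ((x.1, x.2.1), x.2.2)

theorem posSemidef_sendLeft {A C B : Type} [Fintype A] [DecidableEq A] [Fintype C]
    [DecidableEq C] [Fintype B] [DecidableEq B] {X : Matrix (A × (C × B)) (A × (C × B)) ℂ}
    (hX : X.PosSemidef) : (sendLeft A C B X).PosSemidef :=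
  (hX.dephase fun x => x.2.1).submatrix fun x : (A × C) × B => (x.1.1, (x.1.2, x.2))

/-! ### Local unitaries -/

theorem conjugationMap_kronecker_one_apply {A A' B : Type} [Fintype A] [Fintype B] [DecidableEq B]
    (U : Matrix A' A ℂ) (X : Matrix (A × B) (A × B) ℂ) (x y : A' × B) :
    conjugationMap (U ⊗ₖ (1 : Matrix B B ℂ)) X x y =
      ∑ s, ∑ t, U x.1 s * X (s, x.2) (t, y.2) * star (U y.1 t) := by
  simp only [conjugationMap, LinearMap.coe_mk, AddHom.coe_mk, mul_apply, kroneckerMap_apply,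
    conjTranspose_apply, Fintype.sum_prod_type, one_apply]
  rw [Finset.sum_comm' (t' := Finset.univ) (s' := fun _ => Finset.univ) (by simp)]
  simp only [mul_ite, mul_one, mul_zero, ite_mul, zero_mul, Finset.sum_ite_eq, Finset.mem_univ,
    if_true, apply_ite star, star_zero, Finset.sum_mul]
  rw [Finset.sum_eq_single y.2 (by simp +contextual [eq_comm]) (by simp), Finset.sum_comm]
  simp

theorem conjugationMap_one_kronecker_apply {A B B' : Type} [Fintype A] [DecidableEq A] [Fintype B]
    (U : Matrix B' B ℂ) (X : Matrix (A × B) (A × B) ℂ) (x y : A × B') :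
    conjugationMap ((1 : Matrix A A ℂ) ⊗ₖ U) X x y =
      ∑ s, ∑ t, U x.2 s * X (x.1, s) (y.1, t) * star (U y.2 t) := by
  simp only [conjugationMap, LinearMap.coe_mk, AddHom.coe_mk, mul_apply, kroneckerMap_apply,
    conjTranspose_apply, Fintype.sum_prod_type, one_apply]
  simp only [ite_mul, one_mul, zero_mul, Finset.sum_ite_irrel, Finset.sum_const_zero,
    Finset.sum_ite_eq, Finset.mem_univ, if_true, apply_ite star, star_zero, Finset.sum_mul,
    mul_ite, mul_zero]
  rw [Finset.sum_comm]

theorem conjugationMap_one {H K : Type} [Fintype H] [DecidableEq H] [Fintype K] [DecidableEq K]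
    {V : Matrix K H ℂ} (hV : V * Vᴴ = 1) : conjugationMap V 1 = 1 := by
  simp [conjugationMap, hV]

theorem IsUnitaryMap.kronecker {H K H' K' : Type} [Fintype H] [DecidableEq H] [Fintype K]
    [DecidableEq K] [Fintype H'] [DecidableEq H'] [Fintype K'] [DecidableEq K']
    {V : Matrix K H ℂ} {W : Matrix K' H' ℂ} (hV : IsUnitaryMap V) (hW : IsUnitaryMap W) :
    IsUnitaryMap (V ⊗ₖ W) := by
  constructor <;>
  simp [conjTranspose_kronecker, ← mul_kronecker_mul, hV.1, hV.2, hW.1, hW.2]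

theorem isUnitaryMap_one {H : Type} [Fintype H] [DecidableEq H] :
    IsUnitaryMap (1 : Matrix H H ℂ) := by
  constructor <;> simp

theorem IsUnitaryMap.map_star {H K : Type} [Fintype H] [DecidableEq H] [Fintype K]
    [DecidableEq K] {V : Matrix K H ℂ} (hV : IsUnitaryMap V) : IsUnitaryMap (V.map star) := by
  have key : (V.map star)ᴴ = Vᴴ.map star := by ext i j; simp
  rw [IsUnitaryMap, key]
  have hmap : ∀ {I J L : Type} [Fintype J] (P : Matrix I J ℂ) (Q : Matrix J L ℂ),
      P.map star * Q.map star = (P * Q).map star := fun P Q =>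
    (Matrix.map_mul (f := starRingEnd ℂ)).symm
  rw [hmap, hmap, hV.1, hV.2]
  constructor <;> ext i j <;> simp [one_apply, apply_ite]

/-! ### Elementary properties of CLODCC operations -/

section
variable {A B A' B' : Type} {Λ : Matrix (A × B) (A × B) ℂ →ₗ[ℂ] Matrix (A' × B') (A' × B') ℂ}

theorem IsCLODCC.finite (h : IsCLODCC Λ) : Finite A' ∧ Finite B' := by
  induction h with
  | comp _ _ _ _ _ _ => constructor <;> infer_instance
  | _ => constructor <;> infer_instance

theorem iteratedComp_induction {V : Type} [AddCommMonoid V] [Module ℂ V] {E : ℕ → V →ₗ[ℂ] V}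
    {P : V → Prop} (hE : ∀ k X, P X → P (E k X)) {X : V} (hX : P X) (k : ℕ) :
    P (iteratedComp E k X) := by
  induction k with
  | zero => exact hX
  | succ k ih => exact hE k _ ih

theorem IsCLODCC.posSemidef (h : IsCLODCC Λ) :
    ∀ X : Matrix (A × B) (A × B) ℂ, X.PosSemidef → (Λ X).PosSemidef := by
  induction h with
  | id => exact fun X hX => hX
  | unitaryLeft U hU => exact fun X hX => hX.mul_mul_conjTranspose_same _
  | unitaryRight U hU => exact fun X hX => hX.mul_mul_conjTranspose_same _
  | sendRight => exact fun X hX => posSemidef_sendRight hX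
  | sendLeft => exact fun X hX => posSemidef_sendLeft hX
  | comp Λ₂ Λ₁ _ _ ih₂ ih₁ => exact fun X hX => ih₂ _ (ih₁ _ hX)
  | infiniteComp E Λ _ hlim ih =>
    exact fun X hX => posSemidef_of_tendsto (iteratedComp_induction ih hX) (hlim X)

-- Every generator is unital because no ancilla is added and nothing is discarded. This is what
-- forces all POVM elements in J to have trace one.
open Classical in
theorem IsCLODCC.map_one (h : IsCLODCC Λ) : Λ 1 = 1 := by
  induction h with
  | id => rfl
  | unitaryLeft U hU =>
    convert conjugationMap_one (hU.kronecker isUnitaryMap_one).2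
    all_goals infer_instance
  | unitaryRight U hU =>
    convert conjugationMap_one (isUnitaryMap_one.kronecker hU).2
    all_goals infer_instance
  | sendRight =>
    ext x y
    simp only [_root_.sendRight, LinearMap.coe_mk, AddHom.coe_mk, of_apply, one_apply,
      Prod.ext_iff]
    split_ifs <;> simp_all
  | sendLeft =>
    ext x y
    simp only [_root_.sendLeft, LinearMap.coe_mk, AddHom.coe_mk, of_apply, one_apply,
      Prod.ext_iff]
    split_ifs <;> simp_all
  | comp Λ₂ Λ₁ _ _ ih₂ ih₁ => rw [LinearMap.comp_apply, ih₁, ih₂]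
  | @infiniteComp A B _ instA _ instB E Λ _ hlim ih =>
    -- The identity matrix depends on the decidability instances, so these are first made to agree
    -- with the classical ones of the statement.
    obtain rfl : instA = fun _ _ => propDecidable _ := Subsingleton.elim _ _
    obtain rfl : instB = fun _ _ => propDecidable _ := Subsingleton.elim _ _
    refine tendsto_nhds_unique (hlim 1) ?_
    have fixed : ∀ k, iteratedComp E k 1 = 1 :=
      iteratedComp_induction (P := (· = 1)) (fun k X hX => by rw [hX]; exact ih k) rfl
    simp only [fixed]
    exact tendsto_const_nhds

/-! ### Partial transposition -/

/-- The partial transposition as a linear map. -/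
def partialTransposeMap (A B : Type) :
    Matrix (A × B) (A × B) ℂ →ₗ[ℂ] Matrix (A × B) (A × B) ℂ where
  toFun := partialTranspose
  map_add' _ _ := rfl
  map_smul' _ _ := rfl

theorem partialTransposeMap_apply (X : Matrix (A × B) (A × B) ℂ) :
    partialTransposeMap A B X = partialTranspose X := rfl

theorem partialTranspose_apply (X : Matrix (A × B) (A × B) ℂ) (x y : A × B) :
    partialTranspose X x y = X (x.1, y.2) (y.1, x.2) := rfl

theorem tendsto_partialTranspose {X : ℕ → Matrix (A × B) (A × B) ℂ}
    {Y : Matrix (A × B) (A × B) ℂ} (h : Tendsto X atTop (𝓝 Y)) :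
    Tendsto (fun k => partialTranspose (X k)) atTop (𝓝 (partialTranspose Y)) :=
  tendsto_pi_nhds.2 fun x => tendsto_pi_nhds.2 fun y =>
    tendsto_pi_nhds.1 (tendsto_pi_nhds.1 h (x.1, y.2)) (y.1, x.2)

/-- Conjugating a CLODCC operation with the partial transposition gives a CLODCC operation. -/
theorem IsCLODCC.partialTranspose_conj (h : IsCLODCC Λ) :
    IsCLODCC (partialTransposeMap A' B' ∘ₗ Λ ∘ₗ partialTransposeMap A B) := by
  induction h with
  | id => exact IsCLODCC.id
  | unitaryLeft U hU =>
    refine Eq.subst (motive := IsCLODCC) (LinearMap.ext fun X => Matrix.ext fun x y => ?_)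
      (IsCLODCC.unitaryLeft U hU)
    simp [partialTransposeMap_apply, partialTranspose_apply, conjugationMap_kronecker_one_apply]
  -- Transposing the second factor before and after turns conjugation by `U` into conjugation by its
  -- entrywise complex conjugate.
  | unitaryRight U hU =>
    refine Eq.subst (motive := IsCLODCC) (LinearMap.ext fun X => Matrix.ext fun x y => ?_)
      (IsCLODCC.unitaryRight (U.map star) hU.map_star)
    simp only [partialTransposeMap_apply, partialTranspose_apply,
      conjugationMap_one_kronecker_apply, LinearMap.comp_apply, map_apply, star_star]
    rw [Finset.sum_comm]
    exact Finset.sum_congr rfl fun s _ => Finset.sum_congr rfl fun t _ => by ring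
  -- The sent system changes sides, so only the outer Γ transposes it; after dephasing only entries
  -- with equal labels survive, and swapping these does nothing.
  | sendRight =>
    refine Eq.subst (motive := IsCLODCC) (LinearMap.ext fun X => Matrix.ext fun x y => ?_)
      IsCLODCC.sendRight
    simp only [partialTransposeMap_apply, partialTranspose_apply, _root_.sendRight,
      LinearMap.comp_apply, LinearMap.coe_mk, AddHom.coe_mk, of_apply]
    by_cases h : x.2.1 = y.2.1 <;> simp [h, eq_comm]
  | sendLeft =>
    refine Eq.subst (motive := IsCLODCC) (LinearMap.ext fun X => Matrix.ext fun x y => ?_)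
      IsCLODCC.sendLeft
    simp only [partialTransposeMap_apply, partialTranspose_apply, _root_.sendLeft,
      LinearMap.comp_apply, LinearMap.coe_mk, AddHom.coe_mk, of_apply]
    by_cases h : x.1.2 = y.1.2 <;> simp [h]
  | comp Λ₂ Λ₁ _ _ ih₂ ih₁ => exact (IsCLODCC.comp _ _ ih₂ ih₁ :)
  | @infiniteComp A B _ _ _ _ E Λ _ hlim ih =>
    refine IsCLODCC.infiniteComp _ _ ih fun X => ?_
    -- Consecutive inner transpositions cancel, since Γ is an involution.
    have key : ∀ k, iteratedComp (fun k => partialTransposeMap A B ∘ₗ E k ∘ₗ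
        partialTransposeMap A B) k X = partialTranspose (iteratedComp E k (partialTranspose X)) := by
      intro k
      induction k with
      | zero => rfl
      | succ k ih => simp only [iteratedComp, LinearMap.comp_apply, ih]; rfl
    simp only [key]
    exact tendsto_partialTranspose (hlim _)

end

/-! ### CLODCC measurements -/

section
variable {A B : Type} [Fintype A] [DecidableEq A] [Fintype B] [DecidableEq B]

theorem trace_elem_of_mem_clodccPOVMs {M : POVM (A × B)} (hM : M ∈ clodccPOVMs A B)
    (i : M.Outcome) : (M.elem i).trace = 1 := by
  classical
  obtain ⟨A', B', e, h⟩ := hM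
  have h1 := congr_fun₂ h.map_one (e i) (e i)
  simpa [POVM.measurementMap] using h1

/-- The left side is a diagonal entry of `Γ Λ_M Γ (P)`: the outer Γ leaves the diagonal alone, and
the conjugated map is again CLODCC, hence positive. -/
theorem trace_elem_mul_partialTranspose_nonneg {M : POVM (A × B)} (hM : M ∈ clodccPOVMs A B)
    (i : M.Outcome) {P : Matrix (A × B) (A × B) ℂ} (hP : P.PosSemidef) :
    0 ≤ (M.elem i * partialTranspose P).trace := by
  obtain ⟨A', B', e, h⟩ := hM
  have h1 := (h.partialTranspose_conj.posSemidef P hP).diag_nonneg (i := e i)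
  simpa [POVM.measurementMap, partialTransposeMap_apply, partialTranspose_apply] using h1

end
end

noncomputable section

/-! ### The function `x log₂ x` -/

/-- The function `x ↦ x log₂ x`, the negative of the entropy function. -/
def mulLogb (x : ℝ) : ℝ := x * Real.logb 2 x

theorem convexOn_mulLogb : ConvexOn ℝ (Set.Ici 0) mulLogb := by
  have h := Real.convexOn_mul_log.smul (c := (Real.log 2)⁻¹) (by positivity)
  refine h.congr fun x _ => ?_
  simp only [mulLogb, Real.logb, smul_eq_mul]
  ring

/-- A doubly stochastic mixture does not increase `∑ x log₂ x`. -/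
theorem sum_mulLogb_le_of_doublyStochastic {ι κ : Type} [Fintype ι] [Fintype κ] {p : ι → ℝ}
    {q : κ → ℝ} {K : ι → κ → ℝ} (hq : ∀ j, 0 ≤ q j) (hK : ∀ i j, 0 ≤ K i j)
    (hrow : ∀ i, ∑ j, K i j = 1) (hcol : ∀ j, ∑ i, K i j = 1)
    (hp : ∀ i, p i = ∑ j, K i j * q j) : ∑ i, mulLogb (p i) ≤ ∑ j, mulLogb (q j) := by
  calc ∑ i, mulLogb (p i) ≤ ∑ i, ∑ j, K i j * mulLogb (q j) := by
        refine Finset.sum_le_sum fun i _ => ?_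
        have := convexOn_mulLogb.map_sum_le (t := Finset.univ) (w := K i) (p := q)
          (fun j _ => hK i j) (hrow i) (fun j _ => hq j)
        simpa only [smul_eq_mul, ← hp i] using this
    _ = ∑ j, mulLogb (q j) := by
        rw [Finset.sum_comm]
        refine Finset.sum_congr rfl fun j _ => ?_
        rw [← Finset.sum_mul, hcol j, one_mul]

/-- A Leibniz rule, valid without nonvanishing hypotheses because both sides vanish when a factor
does. It is the source of all additivity of entropies below. -/
theorem mulLogb_mul (x y : ℝ) : mulLogb (x * y) = mulLogb x * y + x * mulLogb y := by
  by_cases hx : x = 0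
  · simp [hx, mulLogb]
  by_cases hy : y = 0
  · simp [hy, mulLogb]
  rw [mulLogb, mulLogb, mulLogb, Real.logb_mul hx hy]
  ring

theorem sum_mulLogb_prod {ι κ : Type} [Fintype ι] [Fintype κ] {p : ι → ℝ} {q : κ → ℝ}
    (hp : ∑ i, p i = 1) (hq : ∑ j, q j = 1) :
    ∑ x : ι × κ, mulLogb (p x.1 * q x.2) = ∑ i, mulLogb (p i) + ∑ j, mulLogb (q j) := by
  simp only [mulLogb_mul, Finset.sum_add_distrib, Fintype.sum_prod_type, ← Finset.mul_sum,
    ← Finset.sum_mul, hp, hq, one_mul, mul_one]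

theorem mulLogb_prod {n : ℕ} (x : Fin n → ℝ) :
    mulLogb (∏ k, x k) = ∑ k, ∏ l, if l = k then mulLogb (x l) else x l := by
  induction n with
  | zero => simp [mulLogb]
  | succ n ih =>
    rw [Fin.prod_univ_succ, mulLogb_mul, ih, Fin.sum_univ_succ, Finset.mul_sum]
    simp [Fin.prod_univ_succ, Fin.succ_ne_zero, (Fin.succ_ne_zero _).symm]

/-- After the Leibniz expansion, in each term every factor but one sums to 1. -/
theorem sum_mulLogb_pi {κ : Type} [Fintype κ] [DecidableEq κ] {q : κ → ℝ} (hq : ∑ j, q j = 1)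
    (n : ℕ) : ∑ J : Fin n → κ, mulLogb (∏ k, q (J k)) = n * ∑ j, mulLogb (q j) := by
  simp only [mulLogb_prod]
  rw [Finset.sum_comm]
  have key : ∀ k : Fin n, ∑ J : Fin n → κ, ∏ l, (if l = k then mulLogb (q (J l)) else q (J l)) =
      ∑ j, mulLogb (q j) := by
    intro k
    rw [← Fintype.prod_sum (fun l j => if l = k then mulLogb (q j) else q j),
      Finset.prod_eq_single k (fun l _ hl => by simp [hl, hq]) (by simp)]
    simp
  simp [key]

/-! ### Entropies of the outcome distributions -/

theorem trace_partialTranspose {A B : Type} [Fintype A] [Fintype B]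
    (X : Matrix (A × B) (A × B) ℂ) : (partialTranspose X).trace = X.trace := rfl

section
variable {H : Type} [Fintype H] [DecidableEq H]

theorem POVM.distribution_eq (M : POVM H) (X : Matrix H H ℂ) (i : M.Outcome) :
    M.distribution X i = (M.elem i * X).trace.re := by
  simp [POVM.distribution, POVM.measurementMap]

theorem POVM.sum_distribution (M : POVM H) (X : Matrix H H ℂ) :
    ∑ i, M.distribution X i = X.trace.re := by
  simp only [POVM.distribution_eq, ← Complex.re_sum, ← trace_sum, ← Finset.sum_mul,
    M.sum_eq_one, one_mul]

theorem quantumRelativeEntropy_maximallyMixed {σ : Matrix H H ℂ} [Nonempty H] (hσ : σ.IsHermitian)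
    (htr : σ.trace = 1) :
    quantumRelativeEntropy σ (maximallyMixed H) =
      ((∑ j, mulLogb (hσ.eigenvalues j) + Real.logb 2 (Fintype.card H) : ℝ) : EReal) := by
  have hcard : (Fintype.card H : ℂ) ≠ 0 := by simp
  rw [quantumRelativeEntropy, if_pos]
  · congr 1
    have h1 : cfc (Real.logb 2) (maximallyMixed H) =
        (-(Real.logb 2 (Fintype.card H)) : ℝ) • (1 : Matrix H H ℂ) := by
      have : maximallyMixed H = algebraMap ℝ (Matrix H H ℂ) (Fintype.card H : ℝ)⁻¹ := by
        rw [Algebra.algebraMap_eq_smul_one]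
        ext i j
        simp [maximallyMixed]
      rw [this, cfc_algebraMap, Algebra.algebraMap_eq_smul_one, Real.logb_inv]
    have h2 : (σ * cfc (Real.logb 2) σ).trace.re = ∑ j, mulLogb (hσ.eigenvalues j) := by
      have h3 : σ * hσ.cfc (Real.logb 2) = Unitary.conjStarAlgAut ℂ _ hσ.eigenvectorUnitary
          (diagonal fun j => (mulLogb (hσ.eigenvalues j) : ℂ)) := by
        rw [IsHermitian.cfc]
        nth_rewrite 1 [hσ.spectral_theorem]
        rw [← map_mul, diagonal_mul_diagonal]
        simp [mulLogb]
      rw [hσ.cfc_eq, h3, Unitary.conjStarAlgAut_apply, trace_mul_comm, ← mul_assoc,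
        Unitary.coe_star_mul_self, one_mul, trace_diagonal, ← Complex.ofReal_sum,
        Complex.ofReal_re]
    rw [mul_sub, trace_sub, Complex.sub_re, h2, h1]
    simp [htr]
  · intro v hv
    have : v = 0 := by simpa [maximallyMixed, smul_mulVec, hcard] using hv
    simp [this]

end

section
variable {A B : Type} [Fintype A] [DecidableEq A] [Fintype B] [DecidableEq B]

/-- Because `Tr Mⁱ = 1`, the maximally mixed state yields each outcome with probability 1/dim, so
the relative entropy is `log dim` minus the Shannon entropy. -/
theorem klRelativeEntropy_eq_of_mem_clodccPOVMs [Nonempty (A × B)] {M : POVM (A × B)}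
    (hM : M ∈ clodccPOVMs A B) {ρ : Matrix (A × B) (A × B) ℂ} (hρ : ρ.trace = 1) :
    klRelativeEntropy (M.distribution ρ) (M.distribution (maximallyMixed (A × B))) =
      ((∑ i, mulLogb (M.distribution ρ i) + Real.logb 2 (Fintype.card (A × B)) : ℝ) : EReal) := by
  have hq : ∀ i, M.distribution (maximallyMixed (A × B)) i = (Fintype.card (A × B) : ℝ)⁻¹ := by
    intro i
    rw [POVM.distribution_eq, maximallyMixed, Matrix.mul_smul, mul_one, trace_smul,
      trace_elem_of_mem_clodccPOVMs hM i, smul_eq_mul, mul_one, ← Complex.ofReal_natCast,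
      ← Complex.ofReal_inv, Complex.ofReal_re]
  have hcard : (Fintype.card (A × B) : ℝ) ≠ 0 := Nat.cast_ne_zero.2 Fintype.card_ne_zero
  rw [klRelativeEntropy, if_pos fun i hi => absurd (hq i ▸ hi) (inv_ne_zero hcard)]
  congr 1
  have hsum : ∑ i, M.distribution ρ i = 1 := by rw [POVM.sum_distribution, hρ, Complex.one_re]
  rw [← one_mul (Real.logb 2 _), ← hsum, Finset.sum_mul, ← Finset.sum_add_distrib]
  refine Finset.sum_congr rfl fun i _ => ?_
  rw [hq, div_inv_eq_mul, mulLogb]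
  by_cases hi : M.distribution ρ i = 0
  · simp [hi]
  · rw [Real.logb_mul hi hcard, mul_add]

/-- The outcome distribution of a CLODCC measurement of `ρ` arises by a doubly stochastic matrix
from the spectrum of the partial transpose of `ρ`. -/
theorem sum_mulLogb_distribution_le {K : Type} [Fintype K] [DecidableEq K] {M : POVM (A × B)}
    (hM : M ∈ clodccPOVMs A B) {ρ : Matrix (A × B) (A × B) ℂ} {W : Matrix (A × B) K ℂ}
    (hW : IsUnitaryMap W) {q : K → ℝ} (hq : ∀ j, 0 ≤ q j)
    (hρ : partialTranspose ρ = W * diagonal (fun j => (q j : ℂ)) * Wᴴ) :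
    ∑ i, mulLogb (M.distribution ρ i) ≤ ∑ j, mulLogb (q j) := by
  -- The rank-one projections onto the columns of `W`, an eigenbasis of the partial transpose.
  let P : K → Matrix (A × B) (A × B) ℂ := fun j => vecMulVec (fun x => W x j) (star fun x => W x j)
  have hP : ∀ j, (P j).PosSemidef := fun j => posSemidef_vecMulVec_self_star _
  have hPtr : ∀ j, (P j).trace = 1 := by
    intro j
    have h := congr_fun₂ hW.1 j j
    rw [mul_apply, one_apply_eq] at h
    rw [← h]
    simp [P, trace, vecMulVec_apply, mul_comm]
  have hPsum : ∑ j, partialTranspose (P j) = 1 := by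
    have h : ∑ j, P j = 1 := by
      rw [← hW.2]
      ext x y
      simp [P, Matrix.sum_apply, vecMulVec_apply, mul_apply]
    have h' := congr_arg (partialTransposeMap A B) h
    rw [map_sum] at h'
    refine h'.trans ?_
    ext x y
    simp only [partialTransposeMap_apply, partialTranspose_apply, one_apply, Prod.ext_iff]
    simp [eq_comm]
  have hρP : ρ = ∑ j, (q j : ℂ) • partialTranspose (P j) := by
    have h : partialTranspose ρ = ∑ j, (q j : ℂ) • P j := by
      rw [hρ]
      ext x y
      simp [P, Matrix.sum_apply, vecMulVec_apply, mul_apply, diagonal_apply]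
      exact Finset.sum_congr rfl fun j _ => by ring
    have h' := congr_arg (partialTransposeMap A B) h
    rw [map_sum] at h'
    simpa only [map_smul] using! h'
  -- Rows sum to `Tr Mⁱ = 1` because `∑ Pⱼ^Γ = I^Γ = I`; columns sum to `Tr Pⱼ^Γ = Tr Pⱼ = 1`
  -- because the POVM elements sum to I.
  refine sum_mulLogb_le_of_doublyStochastic
    (K := fun i j => (M.elem i * partialTranspose (P j)).trace.re) hq
    (fun i j => (Complex.nonneg_iff.1 (trace_elem_mul_partialTranspose_nonneg hM i (hP j))).1)
    (fun i => ?_) (fun j => ?_) fun i => ?_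
  · rw [← Complex.re_sum, ← trace_sum, ← Finset.mul_sum, hPsum, mul_one,
      trace_elem_of_mem_clodccPOVMs hM i, Complex.one_re]
  · simp only [← POVM.distribution_eq]
    rw [POVM.sum_distribution, trace_partialTranspose, hPtr, Complex.one_re]
  · rw [POVM.distribution_eq, hρP, Finset.mul_sum, trace_sum, Complex.re_sum]
    refine Finset.sum_congr rfl fun j _ => ?_
    rw [Matrix.mul_smul, trace_smul, smul_eq_mul, Complex.re_ofReal_mul, mul_comm]

/-! ### Tensor powers -/

/-- The `n`-th tensor power of a matrix with bipartite row labels. -/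
def tensorPower {K : Type} (W : Matrix (A × B) K ℂ) (n : ℕ) :
    Matrix ((Fin n → A) × (Fin n → B)) (Fin n → K) ℂ :=
  Matrix.of fun x J => ∏ k, W (x.1 k, x.2 k) (J k)

omit [Fintype A] [DecidableEq A] [Fintype B] [DecidableEq B] in
theorem tensorPower_mul_conjTranspose {K : Type} [Fintype K] [DecidableEq K]
    (V W : Matrix (A × B) K ℂ) (n : ℕ) :
    tensorPower V n * (tensorPower W n)ᴴ = tensorCopies (V * Wᴴ) n := by
  ext x y
  simp only [tensorPower, tensorCopies, mul_apply, conjTranspose_apply, of_apply, star_prod,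
    ← Finset.prod_mul_distrib]
  rw [Fintype.prod_sum]

omit [Fintype A] [Fintype B] in
theorem tensorCopies_one (n : ℕ) : tensorCopies (1 : Matrix (A × B) (A × B) ℂ) n = 1 := by
  ext x y
  simp only [tensorCopies, of_apply, one_apply, Finset.prod_ite_zero, Finset.prod_const_one,
    Finset.mem_univ, true_imp_iff, Prod.ext_iff, funext_iff, forall_and]

theorem IsUnitaryMap.tensorPower {K : Type} [Fintype K] [DecidableEq K] {W : Matrix (A × B) K ℂ}
    (hW : IsUnitaryMap W) (n : ℕ) : IsUnitaryMap (tensorPower W n) := by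
  constructor
  · ext I J
    have h : ∀ i j, ∑ x : A × B, star (W x i) * W x j = (1 : Matrix K K ℂ) i j := fun i j => by
      rw [← hW.1]; rfl
    simp only [_root_.tensorPower, mul_apply, conjTranspose_apply, of_apply, star_prod,
      ← Finset.prod_mul_distrib]
    rw [← (Equiv.arrowProdEquivProdArrow (Fin n) (fun _ => A) (fun _ => B)).sum_comp]
    simp only [Equiv.arrowProdEquivProdArrow, Equiv.coe_fn_mk, Prod.mk.eta]
    rw [← Fintype.prod_sum fun k x => star (W x (I k)) * W x (J k)]
    simp only [h, one_apply, Finset.prod_ite_zero, Finset.prod_const_one,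
      Finset.mem_univ, true_imp_iff, funext_iff]
  · rw [tensorPower_mul_conjTranspose, hW.2, tensorCopies_one]

omit [Fintype A] [DecidableEq A] [Fintype B] [DecidableEq B] in
theorem tensorCopies_eq_tensorPower {K : Type} [Fintype K] [DecidableEq K]
    {W : Matrix (A × B) K ℂ} {q : K → ℝ} {σ : Matrix (A × B) (A × B) ℂ}
    (hσ : σ = W * diagonal (fun j => (q j : ℂ)) * Wᴴ) (n : ℕ) :
    tensorCopies σ n = tensorPower W n *
      diagonal (fun J : Fin n → K => ((∏ k, q (J k) : ℝ) : ℂ)) * (tensorPower W n)ᴴ := by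
  rw [hσ, ← tensorPower_mul_conjTranspose]
  congr 1
  ext x J
  simp [tensorPower, mul_diagonal, Finset.prod_mul_distrib]

omit [DecidableEq A] [DecidableEq B] in
theorem trace_tensorCopies (ρ : Matrix (A × B) (A × B) ℂ) (n : ℕ) :
    (tensorCopies ρ n).trace = ρ.trace ^ n := by
  rw [trace, ← (Equiv.arrowProdEquivProdArrow (Fin n) (fun _ => A) (fun _ => B)).sum_comp]
  simp only [tensorCopies, diag_apply, of_apply, Equiv.arrowProdEquivProdArrow, Equiv.coe_fn_mk,
    Prod.mk.eta]
  rw [← Fintype.prod_sum fun (_ : Fin n) x => ρ x x]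
  simp [trace]

/-- The upper bound on the CLODCC distinguishability of `n` copies from the maximally mixed
state by the spectrum of the partial transpose. -/
theorem clodcc_copies_le [Nonempty (A × B)] {ρ : Matrix (A × B) (A × B) ℂ} (hρ : ρ.trace = 1)
    (hΓ : (partialTranspose ρ).PosSemidef) {n : ℕ} {M : POVM ((Fin n → A) × (Fin n → B))}
    (hM : M ∈ clodccPOVMs (Fin n → A) (Fin n → B)) :
    ∑ i, mulLogb (M.distribution (tensorCopies ρ n) i) +
        Real.logb 2 (Fintype.card ((Fin n → A) × (Fin n → B))) ≤
      n * (∑ j, mulLogb (hΓ.isHermitian.eigenvalues j) + Real.logb 2 (Fintype.card (A × B))) := by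
  have hcard : Fintype.card ((Fin n → A) × (Fin n → B)) = Fintype.card (A × B) ^ n := by
    simp [mul_pow]
  have hspec : partialTranspose ρ = (hΓ.isHermitian.eigenvectorUnitary : Matrix (A × B) (A × B) ℂ) *
      diagonal (fun j => (hΓ.isHermitian.eigenvalues j : ℂ)) *
      (hΓ.isHermitian.eigenvectorUnitary : Matrix (A × B) (A × B) ℂ)ᴴ := by
    conv_lhs => rw [hΓ.isHermitian.spectral_theorem]
    rfl
  have hU : IsUnitaryMap (hΓ.isHermitian.eigenvectorUnitary : Matrix (A × B) (A × B) ℂ) :=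
    ⟨Unitary.coe_star_mul_self _, Unitary.coe_mul_star_self _⟩
  have hsum : ∑ j, hΓ.isHermitian.eigenvalues j = 1 := by
    have := hΓ.isHermitian.trace_eq_sum_eigenvalues
    rw [trace_partialTranspose, hρ] at this
    exact Complex.ofReal_injective (by simpa using! this.symm)
  have h := sum_mulLogb_distribution_le (ρ := tensorCopies ρ n) hM (hU.tensorPower n)
    (q := fun J => ∏ k, hΓ.isHermitian.eigenvalues (J k))
    (fun J => Finset.prod_nonneg fun k _ => hΓ.eigenvalues_nonneg _)
    (tensorCopies_eq_tensorPower hspec n)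
  rw [sum_mulLogb_pi hsum] at h
  rw [hcard, Nat.cast_pow, Real.logb_pow, mul_add]
  exact add_le_add h le_rfl

end
end

noncomputable section

/-! ### Relabelling of the local systems and tensor products of CLODCC operations -/

/-- Relabelling of the local bases. -/
def relabelMap {A A' B B' : Type} (e : A ≃ A') (f : B ≃ B') :
    Matrix (A × B) (A × B) ℂ →ₗ[ℂ] Matrix (A' × B') (A' × B') ℂ where
  toFun X := Matrix.of fun x y => X (e.symm x.1, f.symm x.2) (e.symm y.1, f.symm y.2)
  map_add' _ _ := rfl
  map_smul' _ _ := rfl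

theorem relabelMap_apply {A A' B B' : Type} (e : A ≃ A') (f : B ≃ B')
    (X : Matrix (A × B) (A × B) ℂ) (x y : A' × B') :
    relabelMap e f X x y = X (e.symm x.1, f.symm x.2) (e.symm y.1, f.symm y.2) := rfl

theorem isUnitaryMap_submatrix_one {A A' : Type} [Fintype A] [DecidableEq A] [Fintype A']
    [DecidableEq A'] (e : A ≃ A') : IsUnitaryMap ((1 : Matrix A A ℂ).submatrix e.symm id) := by
  constructor
  · ext i j
    simp only [mul_apply, conjTranspose_apply, submatrix_apply, id, one_apply]
    rw [← e.sum_comp]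
    simp [apply_ite, eq_comm]
  · ext i j
    simp [mul_apply, one_apply, eq_comm]

/-- Relabelling a local basis is conjugation by a permutation matrix, a local unitary. -/
theorem isCLODCC_relabelMap {A A' B B' : Type} [Fintype A] [DecidableEq A] [Fintype B]
    [DecidableEq B] [Fintype A'] [DecidableEq A'] [Fintype B'] [DecidableEq B'] (e : A ≃ A')
    (f : B ≃ B') : IsCLODCC (relabelMap e f) := by
  refine Eq.subst (motive := IsCLODCC) (LinearMap.ext fun X => Matrix.ext fun x y => ?_)
    (IsCLODCC.comp _ _ (IsCLODCC.unitaryRight (A := A') _ (isUnitaryMap_submatrix_one f))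
      (IsCLODCC.unitaryLeft (B := B) _ (isUnitaryMap_submatrix_one e)))
  simp [conjugationMap_one_kronecker_apply, conjugationMap_kronecker_one_apply, relabelMap_apply,
    one_apply, apply_ite]

/-- The block of a matrix on `(A ⊗ C) ⊗ (B ⊗ D)` at given labels of `C ⊗ D`. -/
def tensorBlock {A B C D : Type} (X : Matrix ((A × C) × (B × D)) ((A × C) × (B × D)) ℂ)
    (u v : C × D) : Matrix (A × B) (A × B) ℂ :=
  Matrix.of fun a b => X ((a.1, u.1), (a.2, u.2)) ((b.1, v.1), (b.2, v.2))

/-- `Λ ⊗ id` for a map `Λ` on the operators on `A ⊗ B` and the identity on those on `C ⊗ D`. -/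
def tensorIdMap {A B A' B' : Type} (C D : Type)
    (Λ : Matrix (A × B) (A × B) ℂ →ₗ[ℂ] Matrix (A' × B') (A' × B') ℂ) :
    Matrix ((A × C) × (B × D)) ((A × C) × (B × D)) ℂ →ₗ[ℂ]
      Matrix ((A' × C) × (B' × D)) ((A' × C) × (B' × D)) ℂ where
  toFun X := Matrix.of fun x y =>
    Λ (tensorBlock X (x.1.2, x.2.2) (y.1.2, y.2.2)) (x.1.1, x.2.1) (y.1.1, y.2.1)
  map_add' X Y := by
    ext x y
    exact congr_fun₂ (Λ.map_add _ _) _ _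
  map_smul' c X := by
    ext x y
    exact congr_fun₂ (Λ.map_smul c _) _ _

theorem tensorIdMap_apply {A B A' B' : Type} (C D : Type)
    (Λ : Matrix (A × B) (A × B) ℂ →ₗ[ℂ] Matrix (A' × B') (A' × B') ℂ)
    (X : Matrix ((A × C) × (B × D)) ((A × C) × (B × D)) ℂ) (x y : (A' × C) × (B' × D)) :
    tensorIdMap C D Λ X x y =
      Λ (tensorBlock X (x.1.2, x.2.2) (y.1.2, y.2.2)) (x.1.1, x.2.1) (y.1.1, y.2.1) := rfl

/-- Each generator tensored with the identity is again made of generators: a unitary acquires a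
factor 1, and a sending step is surrounded by local relabellings that carry the sent system past the
spectators. -/
theorem IsCLODCC.tensorIdMap {A B A' B' : Type} (C D : Type) [Fintype C] [DecidableEq C]
    [Fintype D] [DecidableEq D]
    {Λ : Matrix (A × B) (A × B) ℂ →ₗ[ℂ] Matrix (A' × B') (A' × B') ℂ} (h : IsCLODCC Λ) :
    IsCLODCC (tensorIdMap C D Λ) := by
  induction h with
  | id => exact IsCLODCC.id
  | unitaryLeft U hU =>
    refine Eq.subst (motive := IsCLODCC) (LinearMap.ext fun X => Matrix.ext fun x y => ?_)
      (IsCLODCC.unitaryLeft _ (hU.kronecker (isUnitaryMap_one (H := C))))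
    rw [tensorIdMap_apply, conjugationMap_kronecker_one_apply, conjugationMap_kronecker_one_apply]
    simp [Fintype.sum_prod_type, one_apply, tensorBlock, apply_ite, Finset.sum_ite_irrel]
  | unitaryRight U hU =>
    refine Eq.subst (motive := IsCLODCC) (LinearMap.ext fun X => Matrix.ext fun x y => ?_)
      (IsCLODCC.unitaryRight _ (hU.kronecker (isUnitaryMap_one (H := D))))
    rw [tensorIdMap_apply, conjugationMap_one_kronecker_apply, conjugationMap_one_kronecker_apply]
    simp [Fintype.sum_prod_type, one_apply, tensorBlock, apply_ite, Finset.sum_ite_irrel]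
  | @sendRight A E B =>
    refine Eq.subst (motive := IsCLODCC) (LinearMap.ext fun X => Matrix.ext fun x y => ?_)
      (IsCLODCC.comp _ _
        (isCLODCC_relabelMap (Equiv.refl (A × C)) (Equiv.prodAssoc E B D).symm)
        (IsCLODCC.comp _ _ (IsCLODCC.sendRight (A := A × C) (C := E) (B := B × D))
          (isCLODCC_relabelMap ((Equiv.prodAssoc A E C).trans
            (((Equiv.refl A).prodCongr (Equiv.prodComm E C)).trans (Equiv.prodAssoc A C E).symm)) (Equiv.refl (B × D)))))
    rfl
  | @sendLeft A E B =>
    refine Eq.subst (motive := IsCLODCC) (LinearMap.ext fun X => Matrix.ext fun x y => ?_)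
      (IsCLODCC.comp _ _
        (isCLODCC_relabelMap ((Equiv.prodAssoc A C E).trans
          (((Equiv.refl A).prodCongr (Equiv.prodComm C E)).trans (Equiv.prodAssoc A E C).symm)) (Equiv.refl (B × D)))
        (IsCLODCC.comp _ _ (IsCLODCC.sendLeft (A := A × C) (C := E) (B := B × D))
          (isCLODCC_relabelMap (Equiv.refl (A × C)) (Equiv.prodAssoc E B D))))
    rfl
  | comp Λ₂ Λ₁ _ _ ih₂ ih₁ => exact (IsCLODCC.comp _ _ ih₂ ih₁ :)
  | infiniteComp E Λ _ hlim ih =>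
    refine IsCLODCC.infiniteComp _ _ ih fun X => ?_
    have key : ∀ k, iteratedComp (fun k => _root_.tensorIdMap C D (E k)) k =
        _root_.tensorIdMap C D (iteratedComp E k) := by
      intro k
      induction k with
      | zero => rfl
      | succ k ih => simp only [iteratedComp, ih]; rfl
    simp only [key]
    -- Each entry of the tensored map is an entry of the original map applied to one fixed block, so
    -- convergence is inherited entrywise.
    exact tendsto_pi_nhds.2 fun x => tendsto_pi_nhds.2 fun y =>
      tendsto_pi_nhds.1 (tendsto_pi_nhds.1 (hlim _) _) _

/-! ### Relabellings and products of measurements -/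

section
variable {A B C D : Type} [Fintype A] [DecidableEq A] [Fintype B] [DecidableEq B]
  [Fintype C] [DecidableEq C] [Fintype D] [DecidableEq D]

/-- The measurement `M` in relabelled local bases. -/
def POVM.relabel (M : POVM (A × B)) (e : C ≃ A) (f : D ≃ B) : POVM (C × D) where
  Outcome := M.Outcome
  elem i := (M.elem i).submatrix (e.prodCongr f) (e.prodCongr f)
  posSemidef i := (M.posSemidef i).submatrix _
  sum_eq_one := by
    have h := congr_arg (fun X => X.submatrix (e.prodCongr f) (e.prodCongr f)) M.sum_eq_one
    simp only [submatrix_one_equiv] at h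
    rw [← h]
    ext x y
    simp [Matrix.sum_apply]

theorem POVM.relabel_measurementMap (M : POVM (A × B)) (e : C ≃ A) (f : D ≃ B) :
    (M.relabel e f).measurementMap = M.measurementMap ∘ₗ relabelMap e f := by
  refine LinearMap.ext fun X => ?_
  refine congr_arg Matrix.diagonal (funext fun i => ?_)
  simp only [POVM.relabel, trace, diag_apply, mul_apply, submatrix_apply]
  rw [← (e.prodCongr f).sum_comp]
  refine Finset.sum_congr rfl fun x _ => ?_
  rw [← (e.prodCongr f).sum_comp]
  simp [relabelMap_apply]

theorem POVM.relabel_mem_clodccPOVMs {M : POVM (A × B)} (hM : M ∈ clodccPOVMs A B) (e : C ≃ A)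
    (f : D ≃ B) : M.relabel e f ∈ clodccPOVMs C D := by
  classical
  obtain ⟨A', B', g, h⟩ := hM
  have := h.finite.1
  have := h.finite.2
  have := Fintype.ofFinite A'
  have := Fintype.ofFinite B'
  refine ⟨A', B', g, ?_⟩
  rw [POVM.relabel_measurementMap]
  exact (IsCLODCC.comp _ _ h (isCLODCC_relabelMap e f) :)

/-- The product of two measurements. -/
def POVM.prod (M : POVM (A × B)) (N : POVM (C × D)) : POVM ((A × C) × (B × D)) where
  Outcome := M.Outcome × N.Outcome
  elem i := (M.elem i.1 ⊗ₖ N.elem i.2).submatrix (Equiv.prodProdProdComm A C B D)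
    (Equiv.prodProdProdComm A C B D)
  posSemidef i := ((M.posSemidef i.1).kronecker (N.posSemidef i.2)).submatrix _
  sum_eq_one := by
    have h : ∑ i : M.Outcome × N.Outcome, M.elem i.1 ⊗ₖ N.elem i.2 = 1 := by
      rw [← one_kronecker_one, ← M.sum_eq_one, ← N.sum_eq_one]
      ext x y
      simp [Matrix.sum_apply, Fintype.sum_prod_type, Finset.sum_mul_sum]
    rw [← submatrix_one_equiv (Equiv.prodProdProdComm A C B D), ← h]
    ext x y
    simp [Matrix.sum_apply]

/-- Measuring the product amounts to measuring `M` on each block and then `N` on the resulting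
matrix of traces; this matches the sequential implementation in `POVM.prod_mem_clodccPOVMs`. -/
theorem POVM.trace_prod_elem (M : POVM (A × B)) (N : POVM (C × D)) (i : M.Outcome)
    (j : N.Outcome) (X : Matrix ((A × C) × (B × D)) ((A × C) × (B × D)) ℂ) :
    ((M.prod N).elem (i, j) * X).trace = (N.elem j *
      Matrix.of fun u v => (M.elem i * tensorBlock X u v).trace).trace := by
  have sum_eq : ∀ F : (A × C) × (B × D) → ℂ,
      ∑ x, F x = ∑ v : C × D, ∑ u : A × B, F ((u.1, v.1), (u.2, v.2)) := fun F => by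
    rw [← (Equiv.prodProdProdComm A B C D).sum_comp, Fintype.sum_prod_type, Finset.sum_comm]
    rfl
  simp only [POVM.prod, trace, diag_apply, mul_apply, submatrix_apply, kroneckerMap_apply,
    of_apply, tensorBlock, sum_eq, Finset.mul_sum, Equiv.prodProdProdComm_apply]
  refine Finset.sum_congr rfl fun u _ => ?_
  rw [Finset.sum_comm]
  refine Finset.sum_congr rfl fun v _ => Finset.sum_congr rfl fun a _ =>
    Finset.sum_congr rfl fun b _ => by ring

theorem POVM.reindex_measurementMap_apply {H K : Type} [Fintype H] [DecidableEq H]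
    [DecidableEq K] (M : POVM H) (e : M.Outcome ≃ K) (X : Matrix H H ℂ) (x y : K) :
    ((reindexLinearEquiv ℂ ℂ e e).toLinearMap ∘ₗ M.measurementMap) X x y =
      if x = y then (M.elem (e.symm x) * X).trace else 0 := by
  simp [POVM.measurementMap, diagonal_apply]

theorem POVM.prod_mem_clodccPOVMs {M : POVM (A × B)} {N : POVM (C × D)}
    (hM : M ∈ clodccPOVMs A B) (hN : N ∈ clodccPOVMs C D) :
    M.prod N ∈ clodccPOVMs (A × C) (B × D) := by
  classical
  obtain ⟨A', B', g, h⟩ := hM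
  obtain ⟨C', D', g', h'⟩ := hN
  have := h.finite.1
  have := h.finite.2
  have := h'.finite.1
  have := h'.finite.2
  have := Fintype.ofFinite A'
  have := Fintype.ofFinite B'
  have := Fintype.ofFinite C'
  have := Fintype.ofFinite D'
  refine ⟨A' × C', B' × D', (g.prodCongr g').trans (Equiv.prodProdProdComm A' B' C' D'), ?_⟩
  -- Measure the first pair, swap the pairs locally, measure the second pair, swap back.
  refine Eq.subst (motive := IsCLODCC) (LinearMap.ext fun X => Matrix.ext fun x y => ?_)
    (IsCLODCC.comp _ _ (isCLODCC_relabelMap (Equiv.prodComm C' A') (Equiv.prodComm D' B'))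
      (IsCLODCC.comp _ _ (h'.tensorIdMap A' B')
        (IsCLODCC.comp _ _ (isCLODCC_relabelMap (Equiv.prodComm A' C) (Equiv.prodComm B' D))
          (h.tensorIdMap C D))))
  refine Eq.trans (b := ((reindexLinearEquiv ℂ ℂ g' g').toLinearMap ∘ₗ N.measurementMap)
    (Matrix.of fun u v => ((reindexLinearEquiv ℂ ℂ g g).toLinearMap ∘ₗ M.measurementMap)
      (tensorBlock X u v) (x.1.1, x.2.1) (y.1.1, y.2.1)) (x.1.2, x.2.2) (y.1.2, y.2.2)) rfl ?_
  refine Eq.trans ?_ (POVM.reindex_measurementMap_apply (M.prod N) _ X x y).symm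
  simp only [POVM.reindex_measurementMap_apply]
  by_cases hxy : x = y
  · subst hxy
    simp only [if_true]
    exact (POVM.trace_prod_elem M N _ _ X).symm
  · rw [if_neg hxy]
    split_ifs with h1 h2
    · refine absurd ?_ hxy
      simp only [Prod.ext_iff] at h1 h2 ⊢
      tauto
    · exact (congr_arg trace (mul_zero _)).trans (trace_zero _ _)
    · rfl

/-- The measurement of both systems in the computational basis. -/
def computationalPOVM (A B : Type) [Fintype A] [DecidableEq A] [Fintype B] [DecidableEq B] :
    POVM (A × B) where
  Outcome := A × B
  elem i := diagonal (Pi.single i 1)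
  posSemidef i := PosSemidef.diagonal (Pi.single_nonneg.2 zero_le_one)
  sum_eq_one := by
    ext x y
    simp [Matrix.sum_apply, diagonal_apply, one_apply, Pi.single_apply]

/-- The first party sends `A`, dephasing it; the second party then sends back all of `A × B`,
dephasing the rest. This shows that J is nonempty, so its supremum is not `⊥`. -/
theorem computationalPOVM_mem_clodccPOVMs : computationalPOVM A B ∈ clodccPOVMs A B := by
  refine ⟨A × B, Unit, (Equiv.prodPUnit (A × B)).symm, ?_⟩
  refine Eq.subst (motive := IsCLODCC) (LinearMap.ext fun X => Matrix.ext fun x y => ?_)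
    (IsCLODCC.comp _ _ (isCLODCC_relabelMap (Equiv.punitProd (A × B)) (Equiv.refl Unit))
      (IsCLODCC.comp _ _ (IsCLODCC.sendLeft (A := Unit) (C := A × B) (B := Unit))
        (IsCLODCC.comp _ _
          (isCLODCC_relabelMap (Equiv.refl Unit) (Equiv.prodPUnit (A × B)).symm)
          (IsCLODCC.comp _ _ (IsCLODCC.sendRight (A := Unit) (C := A) (B := B))
            (isCLODCC_relabelMap (Equiv.punitProd A).symm (Equiv.refl B))))))
  refine Eq.trans ?_ (POVM.reindex_measurementMap_apply (computationalPOVM A B) _ X x y).symm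
  refine Eq.trans (b := if x.1 = y.1 then if x.1.1 = y.1.1 then X x.1 y.1 else 0 else 0) rfl ?_
  obtain ⟨x, -⟩ := x
  obtain ⟨y, -⟩ := y
  by_cases hxy : x = y
  · simp [hxy, computationalPOVM, trace, diagonal_mul, Pi.single_apply]
    rfl
  · simp [hxy]

end
end

noncomputable section

/-! ### Superadditivity and the limit -/

section
variable {A B C D : Type} [Fintype A] [DecidableEq A] [Fintype B] [DecidableEq B]
  [Fintype C] [DecidableEq C] [Fintype D] [DecidableEq D]

theorem POVM.relabel_distribution (M : POVM (A × B)) (e : C ≃ A) (f : D ≃ B)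
    (X : Matrix (C × D) (C × D) ℂ) :
    (M.relabel e f).distribution X = M.distribution (relabelMap e f X) := by
  funext i
  rw [POVM.distribution, POVM.relabel_measurementMap]
  rfl

/-- The hypothesis `hX` says that `X` is `ρ ⊗ σ` with reordered factors. Hermiticity of `ρ` makes
`Tr(Mⁱρ)` real, so real parts multiply. -/
theorem POVM.prod_distribution (M : POVM (A × B)) (N : POVM (C × D))
    {X : Matrix ((A × C) × (B × D)) ((A × C) × (B × D)) ℂ} {ρ : Matrix (A × B) (A × B) ℂ}
    {σ : Matrix (C × D) (C × D) ℂ} (hρ : ρ.IsHermitian)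
    (hX : ∀ u v, tensorBlock X u v = σ u v • ρ) (i : M.Outcome) (j : N.Outcome) :
    (M.prod N).distribution X (i, j) = M.distribution ρ i * N.distribution σ j := by
  have him : (M.elem i * ρ).trace.im = 0 := by
    refine Complex.conj_eq_iff_im.1 ?_
    rw [starRingEnd_apply, ← trace_conjTranspose, conjTranspose_mul, hρ.eq,
      (M.posSemidef i).isHermitian.eq, trace_mul_comm]
  have h : (Matrix.of fun u v => (M.elem i * tensorBlock X u v).trace) =
      (M.elem i * ρ).trace • σ := by
    ext u v
    rw [of_apply, hX, Matrix.mul_smul, trace_smul, Matrix.smul_apply, smul_eq_mul, smul_eq_mul, mul_comm]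
  refine (POVM.distribution_eq (M.prod N) X (i, j)).trans ?_
  refine (congr_arg Complex.re (POVM.trace_prod_elem M N i j X)).trans ?_
  rw [h, Matrix.mul_smul, trace_smul, smul_eq_mul,
    Complex.mul_re, him, zero_mul, sub_zero, POVM.distribution_eq, POVM.distribution_eq]

omit [Fintype A] [DecidableEq A] [Fintype B] [DecidableEq B] in
theorem tensorBlock_relabelMap_tensorCopies (ρ : Matrix (A × B) (A × B) ℂ) (m n : ℕ)
    (u v : (Fin n → A) × (Fin n → B)) :
    tensorBlock (relabelMap (Fin.appendEquiv m n).symm (Fin.appendEquiv m n).symm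
      (tensorCopies ρ (m + n))) u v = tensorCopies ρ n u v • tensorCopies ρ m := by
  ext a b
  simp [tensorBlock, relabelMap_apply, tensorCopies, Fin.prod_univ_add, Fin.appendEquiv, mul_comm]

omit [Fintype A] [DecidableEq A] [Fintype B] [DecidableEq B] in
theorem isHermitian_tensorCopies {ρ : Matrix (A × B) (A × B) ℂ} (hρ : ρ.IsHermitian) (n : ℕ) :
    (tensorCopies ρ n).IsHermitian := by
  ext x y
  simp only [tensorCopies, conjTranspose_apply, of_apply, star_prod, hρ.apply]

/-- The relative entropy of the outcomes of a CLODCC measurement of `ρ` with respect to the uniform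
distribution. -/
def POVM.divergence (M : POVM (A × B)) (ρ : Matrix (A × B) (A × B) ℂ) : ℝ :=
  ∑ i, mulLogb (M.distribution ρ i) + Real.logb 2 (Fintype.card (A × B))

theorem restrictedRelativeEntropy_clodccPOVMs [Nonempty (A × B)] {ρ : Matrix (A × B) (A × B) ℂ}
    (hρ : ρ.trace = 1) : restrictedRelativeEntropy (clodccPOVMs A B) ρ =
      ⨆ M ∈ clodccPOVMs A B, (M.divergence ρ : EReal) :=
  iSup_congr fun _ => iSup_congr fun hM => klRelativeEntropy_eq_of_mem_clodccPOVMs hM hρ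

/-- Measuring `m` copies and `n` copies independently. -/
theorem exists_divergence_add [Nonempty (A × B)] {ρ : Matrix (A × B) (A × B) ℂ}
    (hρ : IsDensityOperator ρ) {m n : ℕ} {M : POVM ((Fin m → A) × (Fin m → B))}
    {N : POVM ((Fin n → A) × (Fin n → B))} (hM : M ∈ clodccPOVMs (Fin m → A) (Fin m → B))
    (hN : N ∈ clodccPOVMs (Fin n → A) (Fin n → B)) :
    ∃ L ∈ clodccPOVMs (Fin (m + n) → A) (Fin (m + n) → B),
      L.divergence (tensorCopies ρ (m + n)) =
        M.divergence (tensorCopies ρ m) + N.divergence (tensorCopies ρ n) := by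
  refine ⟨(M.prod N).relabel (Fin.appendEquiv m n).symm (Fin.appendEquiv m n).symm,
    POVM.relabel_mem_clodccPOVMs (POVM.prod_mem_clodccPOVMs hM hN) _ _, ?_⟩
  have htr : ∀ k, (tensorCopies ρ k).trace.re = 1 := fun k => by
    rw [trace_tensorCopies, hρ.2, one_pow, Complex.one_re]
  have hcard : ∀ k, Fintype.card ((Fin k → A) × (Fin k → B)) = Fintype.card (A × B) ^ k := by
    intro k
    simp [mul_pow]
  have hsum : ∑ i, mulLogb (((M.prod N).relabel (Fin.appendEquiv m n).symm
        (Fin.appendEquiv m n).symm).distribution (tensorCopies ρ (m + n)) i) =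
      ∑ i : M.Outcome × N.Outcome, mulLogb (M.distribution (tensorCopies ρ m) i.1 *
        N.distribution (tensorCopies ρ n) i.2) := by
    refine Finset.sum_congr rfl fun i _ => congr_arg _ ?_
    rw [POVM.relabel_distribution]
    exact POVM.prod_distribution M N (isHermitian_tensorCopies hρ.1.isHermitian m)
      (tensorBlock_relabelMap_tensorCopies ρ m n) i.1 i.2
  rw [POVM.divergence, hsum, sum_mulLogb_prod (by rw [POVM.sum_distribution, htr])
    (by rw [POVM.sum_distribution, htr]), POVM.divergence, POVM.divergence, hcard, hcard, hcard]
  simp only [Nat.cast_pow, Real.logb_pow, Nat.cast_add]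
  ring

end

end

theorem mainTheorem3 (d : ℕ) (ρ : Matrix (Fin d × Fin d) (Fin d × Fin d) ℂ)
    (hρ : IsDensityOperator ρ) (hΓ : (partialTranspose ρ).PosSemidef) :
    Tendsto (fun n : ℕ => clodccRelativeEntropyCopies ρ n / (n : EReal)) atTop
        (𝓝 (regularizedCLODCCRelativeEntropy ρ)) ∧
      regularizedCLODCCRelativeEntropy ρ ≤
        quantumRelativeEntropy (partialTranspose ρ) (maximallyMixed (Fin d × Fin d)) := by
  have hne : Nonempty (Fin d × Fin d) := by
    by_contra h
    rw [not_nonempty_iff] at h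
    simpa [trace] using hρ.2
  have hne' : ∀ n, Nonempty ((Fin n → Fin d) × (Fin n → Fin d)) := fun n =>
    ⟨fun _ => hne.some.1, fun _ => hne.some.2⟩
  have htr : ∀ n, (tensorCopies ρ n).trace = 1 := fun n => by
    rw [trace_tensorCopies, hρ.2, one_pow]
  set c : ℝ := ∑ j, mulLogb (hΓ.isHermitian.eigenvalues j) +
    Real.logb 2 (Fintype.card (Fin d × Fin d))
  have hbound : ∀ n, ∀ M ∈ clodccPOVMs (Fin n → Fin d) (Fin n → Fin d),
      M.divergence (tensorCopies ρ n) ≤ n * c := fun n M hM => clodcc_copies_le hρ.2 hΓ hM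
  have hsup : ∀ n, clodccRelativeEntropyCopies ρ n =
      ⨆ M ∈ clodccPOVMs (Fin n → Fin d) (Fin n → Fin d),
        (M.divergence (tensorCopies ρ n) : EReal) := fun n =>
    restrictedRelativeEntropy_clodccPOVMs (htr n)
  have hle : ∀ n, clodccRelativeEntropyCopies ρ n ≤ ((n * c : ℝ) : EReal) := fun n => by
    rw [hsup]
    exact iSup₂_le fun M hM => EReal.coe_le_coe_iff.2 (hbound n M hM)
  have hge : ∀ n, ∀ M ∈ clodccPOVMs (Fin n → Fin d) (Fin n → Fin d),
      (M.divergence (tensorCopies ρ n) : EReal) ≤ clodccRelativeEntropyCopies ρ n :=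
    fun n M hM => by
      rw [hsup]
      exact le_iSup₂ (f := fun (M : POVM ((Fin n → Fin d) × (Fin n → Fin d)))
        (_ : M ∈ clodccPOVMs (Fin n → Fin d) (Fin n → Fin d)) =>
          (M.divergence (tensorCopies ρ n) : EReal)) M hM
  -- Bounded above by `n * c` and below by the computational measurement, the suprema are finite,
  -- which reduces the limit to a real sequence.
  obtain ⟨v, hv⟩ : ∃ v : ℕ → ℝ, ∀ n, clodccRelativeEntropyCopies ρ n = v n :=
    ⟨fun n => (clodccRelativeEntropyCopies ρ n).toReal, fun n => (EReal.coe_toReal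
      ((hle n).trans_lt (EReal.coe_lt_top _)).ne
      ((EReal.bot_lt_coe _).trans_le (hge n _ computationalPOVM_mem_clodccPOVMs)).ne').symm⟩
  simp only [hv, EReal.coe_le_coe_iff] at hle hge
  have hlub : ∀ n b, (∀ M ∈ clodccPOVMs (Fin n → Fin d) (Fin n → Fin d),
      M.divergence (tensorCopies ρ n) ≤ b) → v n ≤ b := fun n b hb => by
    rw [← EReal.coe_le_coe_iff, ← hv, hsup]
    exact iSup₂_le fun M hM => EReal.coe_le_coe_iff.2 (hb M hM)
  -- The two suprema are taken one at a time, with the other measurement fixed.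
  have hsub : Subadditive fun n => -v n := by
    intro m n
    have : v m ≤ v (m + n) - v n := hlub m _ fun M hM => by
      have : v n ≤ v (m + n) - M.divergence (tensorCopies ρ m) := hlub n _ fun N hN => by
        obtain ⟨L, hL, h⟩ := exists_divergence_add hρ hM hN
        have := hge _ L hL
        linarith
      linarith
    linarith
  -- The maximum with 0 covers `n = 0`, where the quotient is 0 by convention.
  have hdiv : ∀ n : ℕ, v n / n ≤ max c 0 := fun n => by
    rcases n.eq_zero_or_pos with rfl | hn
    · simp
    · have hn' : (0 : ℝ) < n := by exact_mod_cast hn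
      exact le_max_of_le_left ((div_le_iff₀ hn').2 ((hle n).trans_eq (mul_comm _ _)))
  have hlim := (hsub.tendsto_lim ⟨-max c 0, by
    rintro _ ⟨n, rfl⟩
    simpa [neg_div] using hdiv n⟩).neg
  simp only [neg_div, neg_neg] at hlim
  have hlim' : Tendsto (fun n : ℕ => clodccRelativeEntropyCopies ρ n / (n : EReal)) atTop
      (𝓝 ((-hsub.lim : ℝ) : EReal)) := by
    refine ((continuous_coe_real_ereal.tendsto _).comp hlim).congr fun n => ?_
    rw [hv, Function.comp_apply, EReal.coe_div]
    rfl
  have hreg : regularizedCLODCCRelativeEntropy ρ = ((-hsub.lim : ℝ) : EReal) := hlim'.limUnder_eq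
  rw [hreg]
  refine ⟨hlim', ?_⟩
  rw [quantumRelativeEntropy_maximallyMixed hΓ.isHermitian (by rw [trace_partialTranspose, hρ.2]),
    EReal.coe_le_coe_iff]
  refine le_of_tendsto hlim ((eventually_gt_atTop 0).mono fun n hn => ?_)
  have hn' : (0 : ℝ) < n := by exact_mod_cast hn
  exact (div_le_iff₀ hn').2 ((hle n).trans_eq (mul_comm _ _))
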